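/- Let $T_1=K_4$ and, for $k\ge 1$, let $T_{k+1}$ be obtained from $T_k-u_1u_3$, where $u_1u_3$ is any edge of $T_k$ contained in two triangles, by adding vertices $x,y,z$ and edges $u_1x,u_3y,u_3z,xy,xz,yz$. For $k\ge 2$, the graph $T_k$ contains exactly two $4$-cycles $C_1=u_1u_2u_3u_4$ and $C_2=v_1v_2v_3v_4$ such that $u_1u_3$ and $v_1v_3$ are edges; let $T'_k=T_k-\{u_1u_3,v_1v_3\}$, with interface pairs $u_1u_3$ and $v_1v_3$. In every plane drawing of $T'_k$ (the unbounded face counts as a face), $C_1$ and $C_2$ bound faces, the $4$-faces of $T'_k$, and all other faces are $5$-faces, that is, they are bounded by $5$-cycles. Let $G$ be a finite plane triangle-free graph and let $H$ be a clean Thomas--Walls $5$-tube in $G$: a subgraph of $G$ isomorphic to $T'_5$ such that no vertex or edge of $G$ is drawn in any of the $5$-faces of $H$. Let $C_1$ and $C_2$ be the $4$-cycles bounding the $4$-faces of $H$. Let $G'$ be a graph obtained from $G$ by removing the vertices of $V(H)\setminus V(C_1\cup C_2)$ and instead adding a copy of $T'_4$ whose $4$-faces are bounded by $C_1$ and $C_2$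 and whose interface pairs are the same as those of $H$ (the vertices of the copy outside $C_1\cup C_2$ are new). Then $|G'|=|G|-3$ and $$\alpha(G)-\frac{|G|}{3}=\alpha(G')-\frac{|G'|}{3},$$ where $|\cdot|$ is the number of vertices and $\alpha$ is the independence number. -/

import Mathlib

namespace ThomasWalls

/-! ### Plane graphs, faces -/

/-- The Euclidean plane. -/
abbrev Plane : Type := EuclideanSpace ℝ (Fin 2)

/-- A drawing of the graph `G` in the plane without crossings; a plane graph is a graph together
with such a drawing. Vertices are distinct points, edges are simple (continuous) arcs joining their
ends, an arc contains no vertices besides its ends, and two arcs meet only in (common) vertices. -/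
structure PlaneDrawing {V : Type*} (G : SimpleGraph V) where
  point : V → Plane
  point_injective : Function.Injective point
  arc : G.edgeSet → Set Plane
  arc_isArc : ∀ (x y : V) (h : G.Adj x y), ∃ γ : Path (point x) (point y),
    Function.Injective γ ∧ Set.range γ = arc ⟨s(x, y), h⟩
  mem_of_point_mem_arc : ∀ (x : V) (e : G.edgeSet), point x ∈ arc e → x ∈ (e : Sym2 V)
  exists_point_of_mem_arcs : ∀ e e' : G.edgeSet, e ≠ e' → ∀ p, p ∈ arc e → p ∈ arc e' →
    ∃ x : V, point x = p

/-- The part of the plane covered by the vertices and edges of a subgraph `S` of `G`, in the drawing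
that `S` inherits from `G`. -/
def PlaneDrawing.image {V : Type*} {G : SimpleGraph V} (D : PlaneDrawing G) (S : G.Subgraph) :
    Set Plane :=
  D.point '' S.verts ∪ {p | ∃ e : G.edgeSet, (e : Sym2 V) ∈ S.edgeSet ∧ p ∈ D.arc e}

/-- `f` is a face of the subgraph `S` (with its inherited drawing): a connected component of the
complement of the drawing of `S`. The unbounded component counts as a face, too. -/
def PlaneDrawing.IsFace {V : Type*} {G : SimpleGraph V} (D : PlaneDrawing G) (S : G.Subgraph)
    (f : Set Plane) : Prop :=
  ∃ p ∈ (D.image S)ᶜ, f = connectedComponentIn (D.image S)ᶜ p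

/-- The face `f` of a subgraph is full if some part (vertex or edge) of `G` is drawn in it. -/
def PlaneDrawing.IsFull {V : Type*} {G : SimpleGraph V} (D : PlaneDrawing G)
    (f : Set Plane) : Prop :=
  (f ∩ D.image ⊤).Nonempty

/-- The subgraph of `G` formed by the cycle `u 0, u 1, u 2, u 3`. -/
def cycleSubgraph {V : Type*} (G : SimpleGraph V) (u : Fin 4 → V) : G.Subgraph where
  verts := Set.range u
  Adj x y := G.Adj x y ∧ ∃ i : Fin 4, s(x, y) = s(u i, u (i + 1))
  adj_sub h := h.1
  edge_vert := by
    rintro x y ⟨-, i, hi⟩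
    have hx : x ∈ s(u i, u (i + 1)) := hi ▸ Sym2.mem_mk_left x y
    rcases Sym2.mem_iff.1 hx with h | h
    · exact ⟨i, h.symm⟩
    · exact ⟨i + 1, h.symm⟩
  symm := ⟨fun x y h => ⟨h.1.symm, by rw [Sym2.eq_swap]; exact h.2⟩⟩

/-- The face `f` is bounded by the cycle `u 0, u 1, u 2, u 3`. (A face of a plane graph whose
boundary is a cycle is one of the two sides of this cycle.) -/
def PlaneDrawing.IsBoundedBy {V : Type*} {G : SimpleGraph V} (D : PlaneDrawing G)
    (f : Set Plane) (u : Fin 4 → V) : Prop :=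
  frontier f = D.image (cycleSubgraph G u)

/-! ### Thomas–Walls graphs -/

/-- The graph obtained from `T - ab` by adding new vertices `x`, `y`, `z` (these are `0`, `1`, `2` in
the second summand) and the edges `ax`, `by`, `bz`, `xy`, `xz`, `yz`. -/
def extend {W : Type*} (T : SimpleGraph W) (a b : W) : SimpleGraph (W ⊕ Fin 3) :=
  (T.deleteEdges {s(a, b)}).map (Function.Embedding.inl : W ↪ W ⊕ Fin 3) ⊔
    SimpleGraph.fromEdgeSet {s(.inl a, .inr 0), s(.inl b, .inr 1), s(.inl b, .inr 2),
      s(.inr 0, .inr 1), s(.inr 0, .inr 2), s(.inr 1, .inr 2)}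

/-- `IsThomasWalls k T`: the graph `T` is (isomorphic to) the Thomas–Walls graph `T_k`. Here `T_1` is
`K_4`, and `T_{k+1}` is obtained from `T_k` by applying `extend` to any edge that belongs to (exactly)
two triangles, with its ends in any order. -/
inductive IsThomasWalls : ℕ → ∀ {W : Type}, SimpleGraph W → Prop
  | base {W : Type} (T : SimpleGraph W) (e : (⊤ : SimpleGraph (Fin 4)) ≃g T) : IsThomasWalls 1 T
  | step {k : ℕ} {W W' : Type} (T : SimpleGraph W) (T' : SimpleGraph W') (a b : W)
      (hT : IsThomasWalls k T) (hab : T.Adj a b) (htri : (T.commonNeighbors a b).ncard = 2)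
      (e : extend T a b ≃g T') : IsThomasWalls (k + 1) T'

/-- `u 0, u 1, u 2, u 3` is a 4-cycle in `T` such that `u 0` and `u 2` are adjacent. -/
def IsChordedFourCycle {W : Type*} (T : SimpleGraph W) (u : Fin 4 → W) : Prop :=
  Function.Injective u ∧ (∀ i, T.Adj (u i) (u (i + 1))) ∧ T.Adj (u 0) (u 2)

/-- For `k ≥ 2`: `R` is the reduced Thomas–Walls graph `T'_k`, obtained from `T_k` by deleting the
chords of its two 4-cycles `C₁ = u 0, u 1, u 2, u 3` and `C₂ = v 0, v 1, v 2, v 3` with a chord. The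
interface pairs of `R` are `u 0, u 2` and `v 0, v 2`. -/
def IsReducedThomasWalls (k : ℕ) {W : Type} (R : SimpleGraph W) (u v : Fin 4 → W) : Prop :=
  ∃ T : SimpleGraph W, IsThomasWalls k T ∧ IsChordedFourCycle T u ∧ IsChordedFourCycle T v ∧
    Set.range u ≠ Set.range v ∧ R = T.deleteEdges {s(u 0, u 2), s(v 0, v 2)}

/-! ### Tubes and their reduction -/

/-- The subgraph `H` of `G` is isomorphic to the reduced Thomas–Walls graph `T'_k`; the isomorphism
takes its 4-cycles `C₁`, `C₂` to `u` and `v`, and its interface pairs to `u 0, u 2` and `v 0, v 2`. -/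
def IsTube {V : Type*} {G : SimpleGraph V} (k : ℕ) (H : G.Subgraph) (u v : Fin 4 → V) : Prop :=
  ∃ (W : Type) (R : SimpleGraph W) (a b : Fin 4 → W) (e : R ≃g H.coe),
    IsReducedThomasWalls k R a b ∧ (∀ i, u i = e (a i)) ∧ (∀ i, v i = e (b i))

/-- `H` is a clean Thomas–Walls `k`-tube in the plane graph `G` (`k ≥ 2`): its 5-faces are not full.
The faces of `T'_k` in the plane are two 4-faces, bounded by `C₁` and by `C₂`, and 5-faces, so the
5-faces are the faces bounded by neither `C₁` nor `C₂`. -/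
def PlaneDrawing.IsCleanTube {V : Type*} {G : SimpleGraph V} (D : PlaneDrawing G) (k : ℕ)
    (H : G.Subgraph) (u v : Fin 4 → V) : Prop :=
  IsTube k H u v ∧
    ∀ f, D.IsFace H f → ¬ D.IsBoundedBy f u → ¬ D.IsBoundedBy f v → ¬ D.IsFull f

/-- The vertices of `G` that do not belong to `V(H) \ V(C₁ ∪ C₂)`. -/
def keptVertices {V : Type*} {G : SimpleGraph V} (H : G.Subgraph) (u v : Fin 4 → V) : Set V :=
  {x | x ∈ H.verts → x ∈ Set.range u ∪ Set.range v}

/-- `G'` is obtained from `G` by removing the vertices of `V(H) \ V(C₁ ∪ C₂)` and adding a copy of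
the reduced Thomas–Walls graph `T'_k` with the same 4-cycles `C₁`, `C₂` and the same interface pairs:
`G'` is the union of the remaining part of `G` (embedded by `i`) and of a copy `R` of `T'_k` (embedded
by `j`), which have exactly the vertices of `C₁ ∪ C₂` in common. -/
def IsTubeReplacement {V V' : Type*} {G : SimpleGraph V} (H : G.Subgraph) (u v : Fin 4 → V) (k : ℕ)
    (G' : SimpleGraph V') : Prop :=
  ∃ (W : Type) (R : SimpleGraph W) (a b : Fin 4 → W) (i : keptVertices H u v ↪ V') (j : W ↪ V'),
    IsReducedThomasWalls k R a b ∧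
    (∀ (x : keptVertices H u v) (t : Fin 4), (x : V) = u t → i x = j (a t)) ∧
    (∀ (x : keptVertices H u v) (t : Fin 4), (x : V) = v t → i x = j (b t)) ∧
    Set.range i ∪ Set.range j = Set.univ ∧
    Set.range i ∩ Set.range j ⊆ j '' (Set.range a ∪ Set.range b) ∧
    G' = (G.induce (keptVertices H u v)).map i ⊔ R.map j

/-- `G'` is a single-step TW-tube reduction of the plane graph `G`. -/
def PlaneDrawing.IsSingleStepReduction {V V' : Type*} {G : SimpleGraph V} (D : PlaneDrawing G)
    (G' : SimpleGraph V') : Prop :=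
  ∃ (H : G.Subgraph) (u v : Fin 4 → V), D.IsCleanTube 5 H u v ∧ IsTubeReplacement H u v 4 G'

end ThomasWalls

/-!
The tube is attached to the rest of the graph only along the two cycles `C₁` and `C₂`. An edge of
`G` at an inner vertex of a clean tube `H` that is not an edge of `H` would be drawn in some face of
`H`; this face is full, so it is bounded by `C₁` or by `C₂`, and then the inner vertex would lie on
the boundary cycle (`PlaneDrawing.IsCleanTube.adj_of_adj`). Hence both `G` and `G'` arise from the
same graph `K`, induced by the vertices of `G` that are kept, by filling in a reduced Thomas–Walls
graph along the same two cycles (`IsTubeFilling`).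

It remains to see how many inner vertices can be added to an independent set `S` of `K`. For `T'_k`
with `k = 4` or `k = 5` the maximum is `k - 2 - m`, where `m` counts the cycles among `C₁` and `C₂`
on which `S` contains both vertices outside the interface pair (`fullPairs`). As `m` depends only on
`S`, the independence numbers of `G` and `G'` differ by exactly one, while the numbers of inner
vertices are `8` and `5`.

The maximum is computed in an explicit model: `T_k` is isomorphic to the graph `chain k` on
`0, …, 3k`, with edges `i (i + 2)` for all `i`, `i (i + 3)` for `3 ∣ i`, `i (i + 1)` for
`i ≡ 1 mod 3`, and the two chords `0 1` and `(3k - 1) (3k)`. This graph is symmetric under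
`i ↦ 3k - i`, and the ends of either chord are twins, so that all choices of the extended edge in
the recursive definition of `T_{k+1}` lead to isomorphic graphs.
-/

namespace ThomasWalls

/-! ### An explicit model of the Thomas–Walls graphs -/

/-- An explicit copy of `T_k` on the vertices `0, …, 3k`. For `k ≥ 2` its two 4-cycles with a
chord are `0, 2, 1, 3` and the mirror image of this cycle; their chords are the last two kinds of edges. -/
def chain (k : ℕ) : SimpleGraph (Fin (3 * k + 1)) :=
  SimpleGraph.fromRel fun i j =>
    (j : ℕ) = i + 2 ∨ ((j : ℕ) = i + 3 ∧ (i : ℕ) % 3 = 0) ∨ ((j : ℕ) = i + 1 ∧ (i : ℕ) % 3 = 1) ∨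
      ((i : ℕ) = 0 ∧ (j : ℕ) = 1) ∨ ((i : ℕ) + 1 = 3 * k ∧ (j : ℕ) = 3 * k)

instance (k : ℕ) : DecidableRel (chain k).Adj := by
  unfold chain
  infer_instance

lemma extend_adj_inl_inl {W : Type*} (T : SimpleGraph W) (a b x y : W) :
    (extend T a b).Adj (.inl x) (.inl y) ↔ T.Adj x y ∧ s(x, y) ≠ s(a, b) := by
  simp [extend]

lemma extend_adj_inl_inr {W : Type*} (T : SimpleGraph W) (a b x : W) (j : Fin 3) :
    (extend T a b).Adj (.inl x) (.inr j) ↔ x = a ∧ j = 0 ∨ x = b ∧ j ≠ 0 := by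
  fin_cases j <;> simp [extend]

lemma extend_adj_inr_inl {W : Type*} (T : SimpleGraph W) (a b x : W) (j : Fin 3) :
    (extend T a b).Adj (.inr j) (.inl x) ↔ x = a ∧ j = 0 ∨ x = b ∧ j ≠ 0 := by
  rw [SimpleGraph.adj_comm, extend_adj_inl_inr]

lemma extend_adj_inr_inr {W : Type*} (T : SimpleGraph W) (a b : W) (i j : Fin 3) :
    (extend T a b).Adj (.inr i) (.inr j) ↔ i ≠ j := by
  fin_cases i <;> fin_cases j <;> simp [extend]

/-- Extending isomorphic graphs at corresponding edges gives isomorphic graphs. -/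
def extendIso {W W' : Type*} {T : SimpleGraph W} {T' : SimpleGraph W'} (e : T ≃g T') (a b : W) :
    extend T a b ≃g extend T' (e a) (e b) where
  toEquiv := Equiv.sumCongr e.toEquiv (Equiv.refl _)
  map_rel_iff' := by
    rintro (x | i) (y | j)
    · have h : s(e x, e y) = s(e a, e b) ↔ s(x, y) = s(a, b) := by
        simp
      have h' : T'.Adj (e x) (e y) ↔ T.Adj x y := e.map_adj_iff
      change (extend T' (e a) (e b)).Adj (.inl (e x)) (.inl (e y)) ↔ _
      rw [extend_adj_inl_inl, extend_adj_inl_inl, ne_eq, h, h']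
    · simp [extend_adj_inl_inr]
    · simp [extend_adj_inr_inl]
    · simp [extend_adj_inr_inr]

/-- Extending `chain k` at its last chord gives `chain (k + 1)`: the new vertices `x`, `y`, `z` become
`3k + 1`, `3k + 2`, `3k + 3`. Only `k ≤ 5` is needed, so this and the next facts on `chain k` are
checked by evaluation. -/
def extendChainIso (k : ℕ) (h1 : 1 ≤ k) (h5 : k ≤ 5) :
    extend (chain k) (Fin.rev 1) (Fin.rev 0) ≃g chain (k + 1) where
  toEquiv := finSumFinEquiv.trans (finCongr (by ring))
  map_rel_iff' := by
    simp only [Sum.forall, extend_adj_inl_inl, extend_adj_inl_inr, extend_adj_inr_inl,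
      extend_adj_inr_inr]
    interval_cases k <;> decide +kernel

/-- An edge of `chain k` in two triangles is one of the two chords, and the apices of the two
triangles are the remaining vertices of the corresponding 4-cycle. -/
lemma chain_chord {k : ℕ} (h2 : 2 ≤ k) (h5 : k ≤ 5) : ∀ p q, (chain k).Adj p q →
    ∀ r, (chain k).Adj p r → (chain k).Adj q r → ∀ s, (chain k).Adj p s → (chain k).Adj q s →
      r ≠ s → s(p, q) = s(0, 1) ∧ s(r, s) = s(2, 3) ∨
        s(p, q) = s(Fin.rev 0, Fin.rev 1) ∧ s(r, s) = s(Fin.rev 2, Fin.rev 3) := by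
  interval_cases k <;> decide +kernel

/-- The reversal `i ↦ 3k - i` is an automorphism of `chain k`. -/
def chainRev (k : ℕ) (h1 : 1 ≤ k) (h5 : k ≤ 5) : chain k ≃g chain k where
  toEquiv := Fin.revPerm
  map_rel_iff' := by
    interval_cases k <;> decide +kernel

/-- The ends of the last chord of `chain k` are twins. -/
def chainSwap (k : ℕ) (h1 : 1 ≤ k) (h5 : k ≤ 5) : chain k ≃g chain k where
  toEquiv := Equiv.swap (Fin.rev 0) (Fin.rev 1)
  map_rel_iff' := by
    interval_cases k <;> decide +kernel

/-- Every edge of `chain k` in two triangles can be moved, with either orientation, to the last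
chord. This makes `T_{k+1}` unique up to isomorphism. -/
lemma exists_chain_aut {k : ℕ} (h1 : 1 ≤ k) (h5 : k ≤ 5) {p q r s : Fin (3 * k + 1)}
    (hpq : (chain k).Adj p q) (hpr : (chain k).Adj p r) (hqr : (chain k).Adj q r)
    (hps : (chain k).Adj p s) (hqs : (chain k).Adj q s) (hrs : r ≠ s) :
    ∃ σ : chain k ≃g chain k, σ p = Fin.rev 1 ∧ σ q = Fin.rev 0 := by
  rcases h1.eq_or_lt with rfl | h2
  -- `T_1 = K_4` has six edges in two triangles, not just the two chords.
  · have hperm : ∀ p q : Fin 4, p ≠ q → 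
        ∃ σ : Equiv.Perm (Fin 4), σ p = Fin.rev 1 ∧ σ q = Fin.rev 0 := by
      decide
    have htop : ∀ p q : Fin 4, (chain 1).Adj p q ↔ p ≠ q := by decide
    obtain ⟨σ, hp, hq⟩ := hperm p q hpq.ne
    exact ⟨⟨σ, by intro x y; rw [htop, htop, σ.injective.ne_iff]⟩, hp, hq⟩
  · have hs0 : chainSwap k h1 h5 (Fin.rev 0) = Fin.rev 1 := Equiv.swap_apply_left _ _
    have hs1 : chainSwap k h1 h5 (Fin.rev 1) = Fin.rev 0 := Equiv.swap_apply_right _ _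
    have hr (x) : chainRev k h1 h5 x = Fin.rev x := rfl
    rcases chain_chord h2 h5 p q hpq r hpr hqr s hps hqs hrs with ⟨h, -⟩ | ⟨h, -⟩ <;>
      rcases Sym2.eq_iff.1 h with ⟨rfl, rfl⟩ | ⟨rfl, rfl⟩
    · exact ⟨(chainRev k h1 h5).trans (chainSwap k h1 h5), by rw [RelIso.trans_apply, hr, hs0],
        by rw [RelIso.trans_apply, hr, hs1]⟩
    · exact ⟨chainRev k h1 h5, by simp [hr]⟩
    · exact ⟨chainSwap k h1 h5, hs0, hs1⟩
    · exact ⟨RelIso.refl _, rfl, rfl⟩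

theorem IsThomasWalls.nonempty_iso {k : ℕ} {W : Type} {T : SimpleGraph W}
    (hT : IsThomasWalls k T) : 1 ≤ k ∧ (k ≤ 5 → Nonempty (chain k ≃g T)) := by
  induction hT with
  | base T e =>
    have htop : ∀ p q : Fin 4, (⊤ : SimpleGraph (Fin 4)).Adj p q ↔ (chain 1).Adj p q := by decide
    exact ⟨le_rfl, fun _ => ⟨RelIso.trans ⟨Equiv.refl _, htop _ _⟩ e⟩⟩
  | @step k W W' T T' a b hT hab htri e ih =>
    refine ⟨by omega, fun hk => ?_⟩
    obtain ⟨φ⟩ := ih.2 (by omega)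
    obtain ⟨r, s, hrs, hset⟩ := Set.ncard_eq_two.1 htri
    have hr : r ∈ T.commonNeighbors a b := by simp [hset]
    have hs : s ∈ T.commonNeighbors a b := by simp [hset]
    have hφ {x y} (h : T.Adj x y) : (chain k).Adj (φ.symm x) (φ.symm y) := φ.symm.map_adj_iff.2 h
    obtain ⟨σ, ha, hb⟩ := exists_chain_aut ih.1 (by omega) (hφ hab) (hφ hr.1) (hφ hr.2) (hφ hs.1)
      (hφ hs.2) (φ.symm.injective.ne hrs)
    have e₁ := extendIso (φ.symm.trans σ) a b
    rw [RelIso.trans_apply, RelIso.trans_apply, ha, hb] at e₁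
    exact ⟨((extendChainIso k ih.1 (by omega)).symm.trans e₁.symm).trans e⟩

/-! ### Independent sets in the model -/

lemma IsChordedFourCycle.chain_end {k : ℕ} (h2 : 2 ≤ k) (h5 : k ≤ 5) {u : Fin 4 → Fin (3 * k + 1)}
    (hu : IsChordedFourCycle (chain k) u) :
    s(u 0, u 2) = s(0, 1) ∧ s(u 1, u 3) = s(2, 3) ∨
      s(u 0, u 2) = s(Fin.rev 0, Fin.rev 1) ∧ s(u 1, u 3) = s(Fin.rev 2, Fin.rev 3) :=
  chain_chord h2 h5 _ _ hu.2.2 _ (hu.2.1 0) (hu.2.1 1).symm _ (hu.2.1 3).symm (hu.2.1 2)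
    (hu.1.ne (by decide))

lemma IsChordedFourCycle.map {W W' : Type*} {T : SimpleGraph W} {T' : SimpleGraph W'}
    {u : Fin 4 → W} (hu : IsChordedFourCycle T u) (e : T ≃g T') :
    IsChordedFourCycle T' (e ∘ u) :=
  ⟨e.injective.comp hu.1, fun i => e.map_adj_iff.2 (hu.2.1 i), e.map_adj_iff.2 hu.2.2⟩

lemma mem_range_iff_sym2 {X : Type*} {u : Fin 4 → X} {x : X} :
    x ∈ Set.range u ↔ x ∈ s(u 0, u 2) ∨ x ∈ s(u 1, u 3) := by
  simp only [Set.mem_range, Fin.exists_fin_succ, Sym2.mem_iff, eq_comm]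
  simp
  tauto

lemma range_eq_of_sym2_eq {X : Type*} {u v : Fin 4 → X} (h : s(u 0, u 2) = s(v 0, v 2))
    (h' : s(u 1, u 3) = s(v 1, v 3)) : Set.range u = Set.range v := by
  ext x
  rw [mem_range_iff_sym2, mem_range_iff_sym2, h, h']

/-- The isomorphism with the model can be chosen so that the first cycle comes first. The
vertices of a cycle outside the interface pair cannot be told apart by the hypotheses, and they play
different roles in the model, so the positions are determined only as unordered pairs. -/
theorem IsThomasWalls.exists_chain_iso {k : ℕ} (h2 : 2 ≤ k) (h5 : k ≤ 5) {W : Type}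
    {T : SimpleGraph W} (hT : IsThomasWalls k T) {u v : Fin 4 → W} (hu : IsChordedFourCycle T u)
    (hv : IsChordedFourCycle T v) (hne : Set.range u ≠ Set.range v) :
    ∃ φ : T ≃g chain k, s(φ (u 0), φ (u 2)) = s(0, 1) ∧ s(φ (u 1), φ (u 3)) = s(2, 3) ∧
      s(φ (v 0), φ (v 2)) = s(Fin.rev 0, Fin.rev 1) ∧
      s(φ (v 1), φ (v 3)) = s(Fin.rev 2, Fin.rev 3) := by
  obtain ⟨ψ⟩ := hT.nonempty_iso.2 h5
  have hne' : Set.range (ψ.symm ∘ u) ≠ Set.range (ψ.symm ∘ v) := by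
    rw [Set.range_comp, Set.range_comp]
    exact ψ.symm.injective.image_injective.ne hne
  rcases (hu.map ψ.symm).chain_end h2 h5 with ⟨h, h'⟩ | ⟨h, h'⟩ <;>
    rcases (hv.map ψ.symm).chain_end h2 h5 with ⟨g, g'⟩ | ⟨g, g'⟩
  · exact absurd (range_eq_of_sym2_eq (h.trans g.symm) (h'.trans g'.symm)) hne'
  · exact ⟨ψ.symm, h, h', g, g'⟩
  · have hr (x : Fin (3 * k + 1)) : chainRev k (by omega) h5 x = Fin.rev x := rfl
    refine ⟨ψ.symm.trans (chainRev k (by omega) h5), ?_⟩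
    have hm {x y x' y' : Fin (3 * k + 1)} (h : s(x, y) = s(x', y')) :
        s(Fin.rev x, Fin.rev y) = s(Fin.rev x', Fin.rev y') := congrArg (Sym2.map Fin.rev) h
    simp only [RelIso.trans_apply, hr]
    exact ⟨(hm h).trans (by rw [Fin.rev_rev, Fin.rev_rev]),
      (hm h').trans (by rw [Fin.rev_rev, Fin.rev_rev]), hm g, hm g'⟩
  · exact absurd (range_eq_of_sym2_eq (h.trans g.symm) (h'.trans g'.symm)) hne'

/-- The vertices of `chain k` that lie on neither of the two 4-cycles with a chord. -/
def IsInner (k : ℕ) (x : Fin (3 * k + 1)) : Prop := 4 ≤ (x : ℕ) ∧ (x : ℕ) + 4 ≤ 3 * k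

instance (k : ℕ) : DecidablePred (IsInner k) := fun _ => inferInstanceAs (Decidable (_ ∧ _))

open Classical in
/-- The number of the cycles `u` and `v` for which `S` contains both vertices outside the interface
pair. These are the only vertices of the cycles with neighbours inside the tube. -/
noncomputable def fullPairs {X : Type*} (u v : Fin 4 → X) (S : Finset X) : ℕ :=
  (if u 1 ∈ S ∧ u 3 ∈ S then 1 else 0) + if v 1 ∈ S ∧ v 3 ∈ S then 1 else 0

/-- The upper bound on the number of inner vertices in an independent set. It is an integer linear
consequence of the inequalities that say that each edge contains at most one vertex of `S`. -/
lemma card_filter_isInner_add_le {k : ℕ} (hk : k = 4 ∨ k = 5) (S : Finset (Fin (3 * k + 1)))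
    (hS : ∀ x ∈ S, IsInner k x → ∀ y ∈ S, ¬ (chain k).Adj x y) :
    (S.filter (IsInner k)).card + ((if 2 ∈ S ∧ 3 ∈ S then 1 else 0) +
      if Fin.rev 2 ∈ S ∧ Fin.rev 3 ∈ S then 1 else 0) ≤ k - 2 := by
  let t (x : Fin (3 * k + 1)) : ℕ := if x ∈ S then 1 else 0
  have ht (x y) (hx : IsInner k x) (hxy : (chain k).Adj x y) : t x + t y ≤ 1 := by
    by_cases h : x ∈ S
    · have : y ∉ S := fun h' => hS x h hx y h' hxy
      simp [t, h, this]
    · simp only [t, h, if_false]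
      split_ifs <;> simp
  -- Only upper bounds on the product of two indicators are needed.
  have hp (x y) : ∃ a, (if x ∈ S ∧ y ∈ S then 1 else 0) = a ∧ a ≤ t x ∧ a ≤ t y := by
    by_cases h : x ∈ S <;> by_cases h' : y ∈ S <;> simp [t, h, h']
  obtain ⟨a, ha, ha₂, ha₃⟩ := hp 2 3
  obtain ⟨b, hb, hb₂, hb₃⟩ := hp (Fin.rev 2) (Fin.rev 3)
  have hc : (S.filter (IsInner k)).card = ∑ x ∈ Finset.univ.filter (IsInner k), t x := by
    rw [Finset.sum_boole, Finset.filter_filter, Nat.cast_id]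
    congr 1
    ext x
    simp [and_comm]
  rw [ha, hb, hc]
  clear ha hb hc hp
  clear_value t
  rcases hk with rfl | rfl
  · have hI : Finset.univ.filter (IsInner 4) = {4, 5, 6, 7, 8} := by decide +kernel
    have := ht 4 5 (by decide) (by decide)
    have := ht 4 6 (by decide) (by decide)
    have := ht 5 7 (by decide) (by decide)
    have := ht 6 8 (by decide) (by decide)
    have := ht 7 8 (by decide) (by decide)
    have := ht 4 2 (by decide) (by decide)
    have := ht 5 3 (by decide) (by decide)
    have := ht 6 3 (by decide) (by decide)
    have := ht 8 (Fin.rev 2) (by decide) (by decide)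
    have := ht 7 (Fin.rev 3) (by decide) (by decide)
    have := ht 6 (Fin.rev 3) (by decide) (by decide)
    rw [hI]
    simp
    omega
  · have hI : Finset.univ.filter (IsInner 5) = {4, 5, 6, 7, 8, 9, 10, 11} := by decide +kernel
    have := ht 4 5 (by decide) (by decide)
    have := ht 4 6 (by decide) (by decide)
    have := ht 5 7 (by decide) (by decide)
    have := ht 6 8 (by decide) (by decide)
    have := ht 6 9 (by decide) (by decide)
    have := ht 7 8 (by decide) (by decide)
    have := ht 7 9 (by decide) (by decide)
    have := ht 8 10 (by decide) (by decide)
    have := ht 9 11 (by decide) (by decide)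
    have := ht 10 11 (by decide) (by decide)
    have := ht 4 2 (by decide) (by decide)
    have := ht 5 3 (by decide) (by decide)
    have := ht 6 3 (by decide) (by decide)
    have := ht 11 (Fin.rev 2) (by decide) (by decide)
    have := ht 10 (Fin.rev 3) (by decide) (by decide)
    have := ht 9 (Fin.rev 3) (by decide) (by decide)
    rw [hI]
    simp
    omega

set_option synthInstance.maxSize 1000 in
set_option synthInstance.maxHeartbeats 100000 in
/-- The upper bound of `card_filter_isInner_add_le` is attained for every set `P` of vertices
prescribed on the two cycles; inner vertices of `P` play no role. -/
lemma exists_inner_indep {k : ℕ} (hk : k = 4 ∨ k = 5) (P : Finset (Fin (3 * k + 1))) :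
    ∃ J : Finset (Fin (3 * k + 1)), (∀ x ∈ J, IsInner k x) ∧
      (∀ x ∈ J, ∀ y ∈ J, ¬ (chain k).Adj x y) ∧
      (∀ x ∈ J, ∀ y ∈ P, (chain k).Adj x y → IsInner k y) ∧
      J.card + ((if 2 ∈ P ∧ 3 ∈ P then 1 else 0) +
        if Fin.rev 2 ∈ P ∧ Fin.rev 3 ∈ P then 1 else 0) = k - 2 := by
  -- Only the membership in `P` of the four vertices with inner neighbours matters. If a pair is not
  -- contained in `P`, then `J` may use the neighbours of a vertex missing from `P` and avoids those of
  -- the other one; otherwise it avoids the neighbours of both. This leaves three cases at each end.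
  obtain ⟨l, key⟩ : ∃ l : List (Finset (Fin (3 * k + 1))), ∀ p q p' q' : Bool, ∃ J ∈ l,
      (∀ x ∈ J, IsInner k x) ∧ (∀ x ∈ J, ∀ y ∈ J, ¬ (chain k).Adj x y) ∧
      (∀ x ∈ J, ∀ y, (chain k).Adj x y → IsInner k y ∨ y = 2 ∧ p = false ∨ y = 3 ∧ q = false ∨
        y = Fin.rev 2 ∧ p' = false ∨ y = Fin.rev 3 ∧ q' = false) ∧
      J.card + ((if p = true ∧ q = true then 1 else 0) +
        if p' = true ∧ q' = true then 1 else 0) = k - 2 := by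
    rcases hk with rfl | rfl
    · exact ⟨[∅, {4}, {5}, {7}, {8}, {4, 7}, {4, 8}, {5, 6}, {5, 8}], by decide +kernel⟩
    · exact ⟨[{7}, {4, 7}, {5, 8}, {7, 10}, {7, 11}, {4, 7, 10}, {4, 7, 11}, {5, 6, 10}, {5, 8, 11}],
        by decide +kernel⟩
  have key' := key (decide (2 ∈ P)) (decide (3 ∈ P)) (decide (Fin.rev 2 ∈ P))
    (decide (Fin.rev 3 ∈ P))
  simp only [decide_eq_true_eq, decide_eq_false_iff_not] at key'
  obtain ⟨J, -, hJ, hJ', hJP, hc⟩ := key'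
  refine ⟨J, hJ, hJ', fun x hx y hy hxy => ?_, hc⟩
  rcases hJP x hx y hxy with h | ⟨h, h'⟩ | ⟨h, h'⟩ | ⟨h, h'⟩ | ⟨h, h'⟩
  · exact h
  all_goals exact absurd (h ▸ hy) h'

/-! ### Reduced Thomas–Walls graphs in coordinates -/

/-- Coordinates on a reduced Thomas–Walls graph `R` with cycles `a` and `b`: a bijection with the
vertices of `chain k` that turns `R` into `chain k` without its chords and takes `a` to the first and
`b` to the last 4-cycle. The vertices `2` and `3` are the sides of the first cycle: those outside
the interface pair. -/
structure TubeChart (k : ℕ) {W : Type} (R : SimpleGraph W) (a b : Fin 4 → W) where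
  toEquiv : W ≃ Fin (3 * k + 1)
  injective_left : Function.Injective a
  injective_right : Function.Injective b
  chord_left : s(toEquiv (a 0), toEquiv (a 2)) = s(0, 1)
  sides_left : s(toEquiv (a 1), toEquiv (a 3)) = s(2, 3)
  chord_right : s(toEquiv (b 0), toEquiv (b 2)) = s(Fin.rev 0, Fin.rev 1)
  sides_right : s(toEquiv (b 1), toEquiv (b 3)) = s(Fin.rev 2, Fin.rev 3)
  adj_left : ∀ t, (chain k).Adj (toEquiv (a t)) (toEquiv (a (t + 1)))
  adj_right : ∀ t, (chain k).Adj (toEquiv (b t)) (toEquiv (b (t + 1)))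
  adj_iff : ∀ x y, R.Adj x y ↔ (chain k).Adj (toEquiv x) (toEquiv y) ∧
    s(x, y) ≠ s(a 0, a 2) ∧ s(x, y) ≠ s(b 0, b 2)

theorem IsReducedThomasWalls.nonempty_tubeChart {k : ℕ} (h2 : 2 ≤ k) (h5 : k ≤ 5) {W : Type}
    {R : SimpleGraph W} {a b : Fin 4 → W} (h : IsReducedThomasWalls k R a b) :
    Nonempty (TubeChart k R a b) := by
  obtain ⟨T, hT, ha, hb, hne, rfl⟩ := h
  obtain ⟨φ, h1, h2, h3, h4⟩ := hT.exists_chain_iso h2 h5 ha hb hne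
  exact ⟨⟨φ.toEquiv, ha.1, hb.1, h1, h2, h3, h4, fun t => φ.map_adj_iff.2 (ha.2.1 t),
    fun t => φ.map_adj_iff.2 (hb.2.1 t), fun x y => by
      rw [SimpleGraph.deleteEdges_adj, ← φ.map_adj_iff]
      simp only [Set.mem_insert_iff, Set.mem_singleton_iff, not_or]
      rfl⟩⟩

namespace TubeChart

variable {k : ℕ} {W : Type} {R : SimpleGraph W} {a b : Fin 4 → W}

lemma mem_range_left (c : TubeChart k R a b) (hk : k = 4 ∨ k = 5) (w : W) :
    w ∈ Set.range a ↔ (c.toEquiv w : ℕ) < 4 := by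
  have h : ∀ x : Fin (3 * k + 1), (x = 0 ∨ x = 1) ∨ (x = 2 ∨ x = 3) ↔ (x : ℕ) < 4 := by
    rcases hk with rfl | rfl <;> decide
  rw [← c.toEquiv.injective.mem_set_image, ← Set.range_comp, mem_range_iff_sym2, ← h]
  simp only [Function.comp_apply, c.chord_left, c.sides_left, Sym2.mem_iff]

lemma mem_range_right (c : TubeChart k R a b) (hk : k = 4 ∨ k = 5) (w : W) :
    w ∈ Set.range b ↔ 3 * k < (c.toEquiv w : ℕ) + 4 := by
  have h : ∀ x : Fin (3 * k + 1), (x = Fin.rev 0 ∨ x = Fin.rev 1) ∨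
      (x = Fin.rev 2 ∨ x = Fin.rev 3) ↔ 3 * k < (x : ℕ) + 4 := by
    rcases hk with rfl | rfl <;> decide
  rw [← c.toEquiv.injective.mem_set_image, ← Set.range_comp, mem_range_iff_sym2, ← h]
  simp only [Function.comp_apply, c.chord_right, c.sides_right, Sym2.mem_iff]

lemma isInner_iff (c : TubeChart k R a b) (hk : k = 4 ∨ k = 5) (w : W) :
    IsInner k (c.toEquiv w) ↔ w ∉ Set.range a ∪ Set.range b := by
  rw [Set.mem_union, c.mem_range_left hk, c.mem_range_right hk, IsInner]
  omega

lemma adj_iff_of_inner (c : TubeChart k R a b) {w : W} (hw : w ∉ Set.range a ∪ Set.range b)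
    (w' : W) : R.Adj w w' ↔ (chain k).Adj (c.toEquiv w) (c.toEquiv w') := by
  rw [c.adj_iff, and_iff_left]
  constructor <;> intro h <;> rcases Sym2.eq_iff.1 h with ⟨h, -⟩ | ⟨h, -⟩ <;>
    exact hw (by simp [h])

lemma ne (c : TubeChart k R a b) (hk : k = 4 ∨ k = 5) (s t : Fin 4) : a s ≠ b t := by
  intro h
  have h₁ := (c.mem_range_left hk (a s)).1 ⟨s, rfl⟩
  have h₂ := (c.mem_range_right hk (a s)).1 ⟨t, h.symm⟩
  omega

/-- The edges of the two cycles survive the deletion of the chords. -/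
lemma cycle_adj (c : TubeChart k R a b) (hk : k = 4 ∨ k = 5) (t : Fin 4) :
    R.Adj (a t) (a (t + 1)) ∧ R.Adj (b t) (b (t + 1)) := by
  have h : ∀ t : Fin 4, s(t, t + 1) ≠ s(0, 2) := by decide
  refine ⟨(c.adj_iff _ _).2 ⟨c.adj_left t, fun e => h t ?_, ?_⟩,
    (c.adj_iff _ _).2 ⟨c.adj_right t, ?_, fun e => h t ?_⟩⟩
  · exact Sym2.map.injective c.injective_left e
  · simp [c.ne hk]
  · simp [(c.ne hk _ _).symm]
  · exact Sym2.map.injective c.injective_right e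

/-- The two cycles are induced in the reduced graph, and no edge joins them. -/
lemma boundary_adj (c : TubeChart k R a b) (hk : k = 4 ∨ k = 5) {w w' : W}
    (hw : w ∈ Set.range a ∪ Set.range b) (hw' : w' ∈ Set.range a ∪ Set.range b)
    (h : R.Adj w w') : ∃ t, s(w, w') = s(a t, a (t + 1)) ∨ s(w, w') = s(b t, b (t + 1)) := by
  have hpos : ∀ s t : Fin 4, s = t ∨ s(s, t) = s(0, 2) ∨ s(s, t) = s(1, 3) ∨
      ∃ r, s(s, t) = s(r, r + 1) := by decide
  have hsep : ∀ x y : Fin (3 * k + 1), (x : ℕ) < 4 → 3 * k < (y : ℕ) + 4 →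
      ¬ (chain k).Adj x y := by
    rcases hk with rfl | rfl <;> decide +kernel
  have hsides : s(2, 3) ∉ (chain k).edgeSet ∧ s(Fin.rev 2, Fin.rev 3) ∉ (chain k).edgeSet := by
    simp only [SimpleGraph.mem_edgeSet]
    rcases hk with rfl | rfl <;> decide
  obtain ⟨hc, hl, hr⟩ := (c.adj_iff _ _).1 h
  rcases hw with ⟨s, rfl⟩ | ⟨s, rfl⟩ <;> rcases hw' with ⟨t, rfl⟩ | ⟨t, rfl⟩
  · rcases hpos s t with rfl | e | e | ⟨r, e⟩
    · exact absurd rfl h.ne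
    · exact absurd (congrArg (Sym2.map a) e) hl
    · refine absurd ?_ hsides.1
      rw [← c.sides_left]
      have e' := congrArg (Sym2.map (c.toEquiv ∘ a)) e
      simp only [Sym2.map_mk, Function.comp_apply] at e'
      rw [← e']
      exact hc
    · exact ⟨r, .inl (congrArg (Sym2.map a) e)⟩
  · exact absurd hc (hsep _ _ ((c.mem_range_left hk _).1 ⟨s, rfl⟩)
      ((c.mem_range_right hk _).1 ⟨t, rfl⟩))
  · exact absurd hc.symm (hsep _ _ ((c.mem_range_left hk _).1 ⟨t, rfl⟩)
      ((c.mem_range_right hk _).1 ⟨s, rfl⟩))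
  · rcases hpos s t with rfl | e | e | ⟨r, e⟩
    · exact absurd rfl h.ne
    · exact absurd (congrArg (Sym2.map b) e) hr
    · refine absurd ?_ hsides.2
      rw [← c.sides_right]
      have e' := congrArg (Sym2.map (c.toEquiv ∘ b)) e
      simp only [Sym2.map_mk, Function.comp_apply] at e'
      rw [← e']
      exact hc
    · exact ⟨r, .inr (congrArg (Sym2.map b) e)⟩

lemma fullPairs_eq (c : TubeChart k R a b) (S : Finset W) :
    fullPairs a b S =
      (if 2 ∈ S.map c.toEquiv.toEmbedding ∧ 3 ∈ S.map c.toEquiv.toEmbedding then 1 else 0) +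
        if Fin.rev 2 ∈ S.map c.toEquiv.toEmbedding ∧ Fin.rev 3 ∈ S.map c.toEquiv.toEmbedding then 1
        else 0 := by
  have key {w w' : W} {x y : Fin (3 * k + 1)} (h : s(c.toEquiv w, c.toEquiv w') = s(x, y)) :
      (w ∈ S ∧ w' ∈ S) ↔ x ∈ S.map c.toEquiv.toEmbedding ∧ y ∈ S.map c.toEquiv.toEmbedding := by
    rcases Sym2.eq_iff.1 h with ⟨rfl, rfl⟩ | ⟨rfl, rfl⟩ <;> simp [and_comm]
  classical
  rw [fullPairs]
  congr 1
  · exact if_congr (key c.sides_left) rfl rfl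
  · exact if_congr (key c.sides_right) rfl rfl

open Classical in
lemma card_inner_add_fullPairs_le (c : TubeChart k R a b) (hk : k = 4 ∨ k = 5) (S : Finset W)
    (hS : ∀ x ∈ S, x ∉ Set.range a ∪ Set.range b → ∀ y ∈ S, ¬ R.Adj x y) :
    (S.filter (· ∉ Set.range a ∪ Set.range b)).card + fullPairs a b S ≤ k - 2 := by
  rw [c.fullPairs_eq]
  refine le_trans (le_of_eq ?_)
    (card_filter_isInner_add_le hk (S.map c.toEquiv.toEmbedding) ?_)
  · rw [Finset.filter_map, Finset.card_map]
    congr 2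
    ext x
    simp [c.isInner_iff hk]
  · intro x hx hxi y hy
    obtain ⟨w, hw, rfl⟩ := Finset.mem_map.1 hx
    obtain ⟨w', hw', rfl⟩ := Finset.mem_map.1 hy
    have hi := (c.isInner_iff hk w).1 hxi
    exact fun h => hS w hw hi w' hw' ((c.adj_iff_of_inner hi w').2 h)

lemma exists_inner_indep (c : TubeChart k R a b) (hk : k = 4 ∨ k = 5) (P : Finset W) :
    ∃ J : Finset W, (∀ x ∈ J, x ∉ Set.range a ∪ Set.range b) ∧
      (∀ x ∈ J, ∀ y ∈ J, ¬ R.Adj x y) ∧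
      (∀ x ∈ J, ∀ y ∈ P, R.Adj x y → y ∉ Set.range a ∪ Set.range b) ∧
      J.card + fullPairs a b P = k - 2 := by
  obtain ⟨J, h₁, h₂, h₃, h₄⟩ :=
    ThomasWalls.exists_inner_indep hk (P.map c.toEquiv.toEmbedding)
  have hJ {x} (hx : x ∈ J.map c.toEquiv.symm.toEmbedding) : c.toEquiv x ∈ J := by
    simpa using hx
  have hi {x} (hx : x ∈ J.map c.toEquiv.symm.toEmbedding) := (c.isInner_iff hk x).1 (h₁ _ (hJ hx))
  refine ⟨J.map c.toEquiv.symm.toEmbedding, fun x hx => hi hx, fun x hx y hy h => ?_,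
    fun x hx y hy h => ?_, ?_⟩
  · exact h₂ _ (hJ hx) _ (hJ hy) ((c.adj_iff_of_inner (hi hx) y).1 h)
  · exact (c.isInner_iff hk y).1 (h₃ _ (hJ hx) _ (Finset.mem_map_of_mem _ hy)
      ((c.adj_iff_of_inner (hi hx) y).1 h))
  · rw [c.fullPairs_eq, Finset.card_map, h₄]

lemma ncard_inner (c : TubeChart k R a b) (hk : k = 4 ∨ k = 5) :
    (Set.range a ∪ Set.range b)ᶜ.ncard + 7 = 3 * k := by
  have h : (Finset.univ.filter (IsInner k)).card + 7 = 3 * k := by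
    rcases hk with rfl | rfl <;> decide +kernel
  rw [← h, ← Set.ncard_coe_finset, ← Set.ncard_image_of_injective _ c.toEquiv.injective]
  congr 2
  ext x
  obtain ⟨w, rfl⟩ := c.toEquiv.surjective x
  rw [c.toEquiv.injective.mem_set_image]
  simp [c.isInner_iff hk]

end TubeChart

/-! ### Independent sets and tubes filled in along two cycles -/

/-- `G` is obtained from `K` by gluing in a reduced Thomas–Walls graph `R` along the cycles `u` and
`v`. The embeddings `i` of `K` and `j` of `R` cover `G` and overlap only in the two cycles; inner
vertices of `R` have no neighbours outside `R`. Edges of `R` on the cycles are not required to be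
edges of `G`: adjacency between vertices of `K` is governed by `K`. -/
def IsTubeFilling {X V : Type*} (k : ℕ) (K : SimpleGraph X) (u v : Fin 4 → X)
    (G : SimpleGraph V) : Prop :=
  ∃ (W : Type) (R : SimpleGraph W) (a b : Fin 4 → W) (i : X ↪ V) (j : W ↪ V),
    IsReducedThomasWalls k R a b ∧
    (∀ t, i (u t) = j (a t)) ∧
    (∀ t, i (v t) = j (b t)) ∧
    Set.range i ∪ Set.range j = Set.univ ∧
    (∀ x w, i x = j w → w ∈ Set.range a ∪ Set.range b) ∧
    (∀ x y, G.Adj (i x) (i y) ↔ K.Adj x y) ∧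
    ∀ w ∉ Set.range a ∪ Set.range b, ∀ y, G.Adj (j w) y ↔ ∃ w', R.Adj w w' ∧ j w' = y

namespace IsTubeFilling

variable {X V : Type*} {k : ℕ} {K : SimpleGraph X} {u v : Fin 4 → X} {G : SimpleGraph V}

/-- The filling has `3k - 7` inner vertices. -/
theorem card_add_seven [Finite V] (h : IsTubeFilling k K u v G) (hk : k = 4 ∨ k = 5) :
    Nat.card V + 7 = Nat.card X + 3 * k := by
  obtain ⟨W, R, a, b, i, j, hR, hu, hv, hun, hint, -, -⟩ := h
  obtain ⟨c⟩ := hR.nonempty_tubeChart (by omega) (by omega)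
  rw [← c.ncard_inner hk, ← Set.ncard_univ V, ← Set.ncard_univ X,
    ← Set.ncard_image_of_injective Set.univ i.injective,
    ← Set.ncard_image_of_injective _ j.injective, ← add_assoc, ← Set.ncard_union_eq]
  · congr 2
    symm
    rw [Set.eq_univ_iff_forall]
    intro x
    rcases hun.ge (Set.mem_univ x) with ⟨y, rfl⟩ | ⟨w, rfl⟩
    · exact .inl ⟨y, trivial, rfl⟩
    · by_cases hw : w ∈ Set.range a ∪ Set.range b
      · rcases hw with ⟨t, rfl⟩ | ⟨t, rfl⟩
        · exact .inl ⟨u t, trivial, hu t⟩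
        · exact .inl ⟨v t, trivial, hv t⟩
      · exact .inr ⟨w, hw, rfl⟩
  · rw [Set.disjoint_left]
    rintro _ ⟨x, -, rfl⟩ ⟨w, hw, h⟩
    exact hw (hint x w h.symm)

open Classical in
/-- The independence number of a filling is `k - 2` plus the maximum of `|S| - fullPairs u v S` over
the independent sets `S` of `K`. -/
theorem le_indepNum_iff [Finite V] (h : IsTubeFilling k K u v G) (hk : k = 4 ∨ k = 5) (n : ℕ) :
    n + (k - 2) ≤ G.indepNum ↔
      ∃ S : Finset X, K.IsIndepSet S ∧ n + fullPairs u v S ≤ S.card := by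
  obtain ⟨W, R, a, b, i, j, hR, hu, hv, hun, hint, hK, hG⟩ := h
  obtain ⟨c⟩ := hR.nonempty_tubeChart (by omega) (by omega)
  constructor
  · intro hn
    obtain ⟨I, hI, hIc⟩ := G.exists_isNIndepSet_indepNum
    let S := I.preimage i i.injective.injOn
    let P := I.preimage j j.injective.injOn
    have hS {x} : x ∈ S ↔ i x ∈ I := by simp [S]
    have hP {w} : w ∈ P ↔ j w ∈ I := by simp [P]
    refine ⟨S, fun x hx y hy hxy h => hI (hS.1 hx) (hS.1 hy) (i.injective.ne hxy)
      ((hK x y).2 h), ?_⟩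
    have hfull : fullPairs u v S = fullPairs a b P := by simp [fullPairs, hS, hP, hu, hv]
    have hcard : I.card ≤ S.card + (P.filter (· ∉ Set.range a ∪ Set.range b)).card := by
      rw [← Finset.card_map i, ← Finset.card_map j]
      refine le_trans (Finset.card_le_card fun x hx => ?_) (Finset.card_union_le _ _)
      rw [Finset.mem_union]
      rcases hun.ge (Set.mem_univ x) with ⟨y, rfl⟩ | ⟨w, rfl⟩
      · exact .inl (Finset.mem_map_of_mem _ (hS.2 hx))
      · by_cases hw : w ∈ Set.range a ∪ Set.range b
        · left
          rcases hw with ⟨t, rfl⟩ | ⟨t, rfl⟩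
          · rw [← hu] at hx ⊢
            exact Finset.mem_map_of_mem _ (hS.2 hx)
          · rw [← hv] at hx ⊢
            exact Finset.mem_map_of_mem _ (hS.2 hx)
        · exact .inr (Finset.mem_map_of_mem _ (Finset.mem_filter.2 ⟨hP.2 hx, hw⟩))
    have hle := c.card_inner_add_fullPairs_le hk P fun x hx hxi y hy hxy =>
      hI (hP.1 hx) (hP.1 hy) (j.injective.ne hxy.ne) ((hG x hxi _).2 ⟨y, hxy, rfl⟩)
    omega
  · rintro ⟨S, hS, hn⟩
    let P := (S.map i).preimage j j.injective.injOn
    have hP {w} : w ∈ P ↔ j w ∈ S.map i := by simp [P]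
    obtain ⟨J, hJ, hJJ, hJP, hJc⟩ := c.exists_inner_indep hk P
    have hfull : fullPairs u v S = fullPairs a b P := by
      simp only [fullPairs, hP, ← hu, ← hv, Finset.mem_map']
    have hdisj : Disjoint (S.map i) (J.map j) := by
      rw [Finset.disjoint_left]
      intro x hx hx'
      obtain ⟨y, -, rfl⟩ := Finset.mem_map.1 hx
      obtain ⟨w, hw, h⟩ := Finset.mem_map.1 hx'
      exact hJ w hw (hint y w h.symm)
    have hcross {x w} (hx : x ∈ S) (hw : w ∈ J) : ¬ G.Adj (j w) (i x) := by
      intro h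
      obtain ⟨w', hww', h'⟩ := (hG w (hJ w hw) _).1 h
      exact hJP w hw w' (hP.2 (h' ▸ Finset.mem_map_of_mem _ hx)) hww' (hint x w' h'.symm)
    have hI : G.IsIndepSet (S.map i ∪ J.map j : Finset V) := by
      intro x hx y hy hxy
      rw [Finset.mem_coe, Finset.mem_union, Finset.mem_map, Finset.mem_map] at hx hy
      rcases hx with ⟨x, hx, rfl⟩ | ⟨w, hw, rfl⟩ <;> rcases hy with ⟨y, hy, rfl⟩ | ⟨w', hw', rfl⟩
      · rw [hK]
        exact hS hx hy (fun h => hxy (h ▸ rfl))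
      · exact fun h => hcross hx hw' h.symm
      · exact hcross hy hw
      · rw [hG w (hJ w hw)]
        rintro ⟨w'', h, h'⟩
        rw [j.injective h'] at h
        exact hJJ w hw w' hw' h
    have := hI.card_le_indepNum
    rw [Finset.card_union_of_disjoint hdisj, Finset.card_map, Finset.card_map] at this
    omega

end IsTubeFilling

/-! ### Clean tubes and their replacements are fillings -/

lemma PlaneDrawing.mem_verts_of_point_mem_image {V : Type*} {G : SimpleGraph V}
    (D : PlaneDrawing G) {S : G.Subgraph} {x : V} (h : D.point x ∈ D.image S) : x ∈ S.verts := by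
  rcases h with ⟨y, hy, h⟩ | ⟨e, he, h⟩
  · rwa [← D.point_injective h]
  · exact S.mem_verts_of_mem_edge he (D.mem_of_point_mem_arc x e h)

/-- In a plane graph, all edges at an inner vertex of a clean tube belong to the tube. -/
theorem PlaneDrawing.IsCleanTube.adj_of_adj {V : Type*} {G : SimpleGraph V} {D : PlaneDrawing G}
    {k : ℕ} {H : G.Subgraph} {u v : Fin 4 → V} (h : D.IsCleanTube k H u v) {x y : V}
    (hx : x ∈ H.verts) (hxuv : x ∉ Set.range u ∪ Set.range v) (hxy : G.Adj x y) : H.Adj x y := by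
  by_contra hH
  obtain ⟨γ, hγ, hγr⟩ := D.arc_isArc x y hxy
  have hmem (t) : γ t ∈ D.arc ⟨s(x, y), hxy⟩ := hγr ▸ Set.mem_range_self t
  have hpoint {t : unitInterval} (ht : t ∈ Set.Ioo 0 1) (z : V) : D.point z ≠ γ t := by
    intro hz
    have hze := D.mem_of_point_mem_arc z ⟨s(x, y), hxy⟩ (hz ▸ hmem t)
    rcases Sym2.mem_iff.1 hze with rfl | rfl
    · exact ht.1.ne (hγ (γ.source.trans hz))
    · exact ht.2.ne (hγ (hz.symm.trans γ.target.symm))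
  -- The open arc of an edge outside `H` avoids the drawing of `H`, so it lies in a single face.
  have hsub : γ '' Set.Ioo 0 1 ⊆ (D.image H)ᶜ := by
    rintro _ ⟨t, ht, rfl⟩ (⟨z, -, hz⟩ | ⟨e, he, hte⟩)
    · exact hpoint ht z hz
    · by_cases hee : e = ⟨s(x, y), hxy⟩
      · subst hee
        exact hH he
      · obtain ⟨z, hz⟩ := D.exists_point_of_mem_arcs e _ hee _ hte (hmem t)
        exact hpoint ht z hz
  let m : unitInterval := ⟨1 / 2, by norm_num, by norm_num⟩
  have hm : m ∈ Set.Ioo 0 1 := by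
    constructor <;> rw [← Subtype.coe_lt_coe] <;> norm_num [m]
  have hmγ : γ m ∈ γ '' Set.Ioo 0 1 := Set.mem_image_of_mem _ hm
  let f := connectedComponentIn (D.image H)ᶜ (γ m)
  have hsubf : γ '' Set.Ioo 0 1 ⊆ f :=
    (isPreconnected_Ioo.image γ γ.continuous.continuousOn).subset_connectedComponentIn hmγ hsub
  have hfull : D.IsFull f := ⟨γ m, hsubf hmγ, .inr ⟨⟨s(x, y), hxy⟩, hxy, hmem m⟩⟩
  have hcl : D.point x ∈ closure f := by
    refine closure_mono hsubf (image_closure_subset_closure_image γ.continuous ⟨0, ?_, γ.source⟩)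
    rw [closure_Ioo (by simp)]
    simp
  -- The end `x` of the arc is on the boundary of this face.
  have hfr : D.point x ∈ frontier f :=
    ⟨hcl, fun hi => connectedComponentIn_subset _ _ (interior_subset hi) (.inl ⟨x, hx, rfl⟩)⟩
  have hbdd {w : Fin 4 → V} (hw : D.IsBoundedBy f w) : x ∈ Set.range w :=
    D.mem_verts_of_point_mem_image (S := cycleSubgraph G w) (hw ▸ hfr)
  exact h.2 f ⟨γ m, hsub hmγ, rfl⟩ (fun hu => hxuv (.inl (hbdd hu)))
    (fun hv => hxuv (.inr (hbdd hv))) hfull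

theorem PlaneDrawing.IsCleanTube.isTubeFilling {V : Type*} {G : SimpleGraph V} {D : PlaneDrawing G}
    {k : ℕ} {H : G.Subgraph} {u v : Fin 4 → V} (h : D.IsCleanTube k H u v) :
    IsTubeFilling k (G.induce (keptVertices H u v)) (fun t => ⟨u t, fun _ => .inl ⟨t, rfl⟩⟩)
      (fun t => ⟨v t, fun _ => .inr ⟨t, rfl⟩⟩) G := by
  have hadj := @h.adj_of_adj
  obtain ⟨⟨W, R, a, b, e, hR, hu, hv⟩, -⟩ := h
  let j : W ↪ V := e.toEquiv.toEmbedding.trans (Function.Embedding.subtype _)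
  have hj (w) : j w = e w := rfl
  have hmem {w} : j w ∈ Set.range u ∪ Set.range v → w ∈ Set.range a ∪ Set.range b := by
    rintro (⟨t, ht⟩ | ⟨t, ht⟩)
    · exact .inl ⟨t, j.injective (by rw [← ht, hu]; rfl)⟩
    · exact .inr ⟨t, j.injective (by rw [← ht, hv]; rfl)⟩
  refine ⟨W, R, a, b, Function.Embedding.subtype _, j, hR, hu, hv, ?_, ?_, fun _ _ => Iff.rfl, ?_⟩
  · rw [Set.eq_univ_iff_forall]
    intro x
    by_cases hx : x ∈ H.verts
    · exact .inr ⟨e.symm ⟨x, hx⟩, by simp [hj]⟩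
    · exact .inl ⟨⟨x, fun h => absurd h hx⟩, rfl⟩
  · rintro ⟨_, hx⟩ w rfl
    exact hmem (hx (e w).2)
  · intro w hw y
    constructor
    · intro h
      have hH : H.Adj (e w) y := hadj (e w).2 (fun h => hw (hmem h)) h
      refine ⟨e.symm ⟨y, hH.snd_mem⟩, ?_, by simp [hj]⟩
      rw [← e.map_adj_iff, e.apply_symm_apply]
      exact hH
    · rintro ⟨w', h, rfl⟩
      exact H.adj_sub (e.map_adj_iff.2 h)

/-- The replacement of a tube is a filling of the same graph. Edges of the new tube between vertices
of the two cycles add nothing, since the edges of these cycles are already present in the old one. -/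
theorem IsTubeReplacement.isTubeFilling {V V' : Type*} {G : SimpleGraph V} {G' : SimpleGraph V'}
    {k l : ℕ} {H : G.Subgraph} {u v : Fin 4 → V} (h : IsTubeReplacement H u v k G')
    (hk : k = 4 ∨ k = 5) (hH : IsTube l H u v) (hl : l = 4 ∨ l = 5) :
    IsTubeFilling k (G.induce (keptVertices H u v)) (fun t => ⟨u t, fun _ => .inl ⟨t, rfl⟩⟩)
      (fun t => ⟨v t, fun _ => .inr ⟨t, rfl⟩⟩) G' := by
  obtain ⟨W, R, a, b, i, j, hR, hu, hv, hun, hint, rfl⟩ := h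
  obtain ⟨c⟩ := hR.nonempty_tubeChart (by omega) (by omega)
  have hint' (x w) (h : i x = j w) : w ∈ Set.range a ∪ Set.range b := by
    obtain ⟨w', hw', h'⟩ := hint ⟨⟨x, rfl⟩, ⟨w, h.symm⟩⟩
    rwa [← j.injective (h'.trans h)]
  have hcyc (t) : G.Adj (u t) (u (t + 1)) ∧ G.Adj (v t) (v (t + 1)) := by
    obtain ⟨W₀, R₀, a₀, b₀, e, hR₀, hu₀, hv₀⟩ := hH
    obtain ⟨c₀⟩ := hR₀.nonempty_tubeChart (by omega) (by omega)
    rw [hu₀, hu₀, hv₀, hv₀]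
    exact ⟨H.adj_sub (e.map_adj_iff.2 (c₀.cycle_adj hl t).1),
      H.adj_sub (e.map_adj_iff.2 (c₀.cycle_adj hl t).2)⟩
  refine ⟨W, R, a, b, i, j, hR, fun t => hu _ t rfl, fun t => hv _ t rfl, hun, hint', ?_, ?_⟩
  · intro x y
    rw [SimpleGraph.sup_adj, SimpleGraph.map_adj_apply]
    refine or_iff_left_of_imp ?_
    rintro ⟨-, w, w', hww', hw, hw'⟩
    have key {p : Fin 4 → W} {z : Fin 4 → V} (hz : ∀ t, ∃ h, i ⟨z t, h⟩ = j (p t))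
        (hG : ∀ t, G.Adj (z t) (z (t + 1))) (t) (h : s(w, w') = s(p t, p (t + 1))) :
        G.Adj x y := by
      have hxz {x t} (h : i x = j (p t)) : (x : V) = z t := by
        obtain ⟨h', ht⟩ := hz t
        rw [i.injective (h.trans ht.symm)]
      rcases Sym2.eq_iff.1 h with ⟨rfl, rfl⟩ | ⟨rfl, rfl⟩
      · rw [hxz hw.symm, hxz hw'.symm]
        exact hG t
      · rw [hxz hw.symm, hxz hw'.symm]
        exact (hG t).symm
    obtain ⟨t, h | h⟩ := c.boundary_adj hk (hint' x w hw.symm) (hint' y w' hw'.symm) hww'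
    · exact key (fun t => ⟨fun _ => .inl ⟨t, rfl⟩, hu ⟨u t, _⟩ t rfl⟩) (fun t => (hcyc t).1) t h
    · exact key (fun t => ⟨fun _ => .inr ⟨t, rfl⟩, hv ⟨v t, _⟩ t rfl⟩) (fun t => (hcyc t).2) t h
  · intro w hw y
    rw [SimpleGraph.sup_adj]
    constructor
    · rintro (⟨-, x, x', -, hx, -⟩ | ⟨-, w₁, w₂, h, hw₁, hw₂⟩)
      · exact absurd (hint' x w hx) hw
      · rw [← j.injective hw₁]
        exact ⟨w₂, h, hw₂⟩
    · rintro ⟨w', h, rfl⟩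
      exact .inr ⟨j.injective.ne h.ne, w, w', h, rfl, rfl⟩

end ThomasWalls

theorem lemma3 {V V' : Type*} [Finite V] [Finite V'] (G : SimpleGraph V)
    (D : ThomasWalls.PlaneDrawing G) (hG : G.CliqueFree 3) (G' : SimpleGraph V')
    (h : D.IsSingleStepReduction G') :
    (Nat.card V' : ℤ) = (Nat.card V : ℤ) - 3 ∧
      (G.indepNum : ℚ) - (Nat.card V : ℚ) / 3 = (G'.indepNum : ℚ) - (Nat.card V' : ℚ) / 3 := by
  obtain ⟨H, u, v, hH, hG'⟩ := h
  have h₅ := hH.isTubeFilling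
  have h₄ := hG'.isTubeFilling (.inl rfl) hH.1 (.inr rfl)
  have hc : Nat.card V = Nat.card V' + 3 := by
    have := h₅.card_add_seven (.inr rfl)
    have := h₄.card_add_seven (.inl rfl)
    omega
  have hle (n : ℕ) : n + 3 ≤ G.indepNum ↔ n + 2 ≤ G'.indepNum :=
    (h₅.le_indepNum_iff (.inr rfl) n).trans (h₄.le_indepNum_iff (.inl rfl) n).symm
  -- Both independence numbers are large enough for the truncated subtractions below.
  have h0 : 0 + 3 ≤ G.indepNum :=
    (h₅.le_indepNum_iff (.inr rfl) 0).2 ⟨∅, by simp, by simp [ThomasWalls.fullPairs]⟩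
  have hα : G.indepNum = G'.indepNum + 1 := by
    have h₁ := (hle (G.indepNum - 3)).1 (by omega)
    have h₂ := (hle (G'.indepNum - 2)).2 (by omega)
    omega
  rw [hc, hα]
  push_cast
  exact ⟨by ring, by ring⟩
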